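/- For $n\ge 1$ let $$L_n=\Big\{z\in\mathbb C^n:\ \sum_{j=1}^n|z_j|^2<1,\ \sqrt{\Big(\sum_{j=1}^n|z_j|^2\Big)^2-\Big|\sum_{j=1}^n z_j^2\Big|^2}<1-\sum_{j=1}^n|z_j|^2\Big\}$$ be the Lie ball (the classical Cartan domain of type IV) and let $\mathbb L_n=\Lambda_n(L_n)$, where $\Lambda_n(z_1,z_2,\dots,z_n)=(z_1^2,z_2,\dots,z_n)$. A domain in $\mathbb C^n$ is a nonempty connected open set. A domain $D\subset\mathbb C^n$ can be exhausted by domains biholomorphic to convex domains if for every compact set $K\subset D$ there is a domain $G$ with $K\subset G\subset D$ such that $G$ is biholomorphic to a (not necessarily bounded) convex domain in $\mathbb C^n$; in particular, this is the case if $D$ is the union of an increasing sequence of domains that are biholomorphic to convex domains. Theorem. For every $n\ge 2$, the domain $\mathbb L_n$ cannot be exhausted by domains biholomorphic to convex domains. -/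

import Mathlib

/-- A domain in `ℂⁿ`: a nonempty connected open set. -/
def IsDomainIn {n : ℕ} (G : Set (Fin n → ℂ)) : Prop :=
  IsOpen G ∧ IsConnected G

/-- `G` and `C` are biholomorphic: there are mutually inverse holomorphic maps `f : G → C` and
`g : C → G`. On open sets, holomorphic means complex (Fréchet) differentiable. -/
def Biholomorphic {n : ℕ} (G C : Set (Fin n → ℂ)) : Prop :=
  ∃ f g : (Fin n → ℂ) → (Fin n → ℂ),
    DifferentiableOn ℂ f G ∧ DifferentiableOn ℂ g C ∧
    Set.MapsTo f G C ∧ Set.MapsTo g C G ∧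
    Set.LeftInvOn g f G ∧ Set.RightInvOn g f C

/-- The family of all domains in `ℂⁿ` that are biholomorphic to a convex domain in `ℂⁿ`. The
convex domain is not required to be bounded. -/
def domainsBiholomorphicToConvex (n : ℕ) : Set (Set (Fin n → ℂ)) :=
  {G | IsDomainIn G ∧ ∃ C : Set (Fin n → ℂ), IsDomainIn C ∧ Convex ℝ C ∧ Biholomorphic G C}

/-- `D` can be exhausted by members of the family `𝒢`: every compact subset of `D` is contained
in a member of `𝒢` that is itself contained in `D`. -/
def IsExhaustedBy {n : ℕ} (D : Set (Fin n → ℂ)) (𝒢 : Set (Set (Fin n → ℂ))) : Prop :=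
  ∀ K : Set (Fin n → ℂ), IsCompact K → K ⊆ D → ∃ G ∈ 𝒢, K ⊆ G ∧ G ⊆ D

/-- A set that is the union of an increasing sequence of open members of `𝒢` is exhausted by
`𝒢`. So not being exhausted in the sense above also excludes increasing sequences. -/
theorem IsExhaustedBy.of_monotone {n : ℕ} {D : Set (Fin n → ℂ)} {𝒢 : Set (Set (Fin n → ℂ))}
    (G : ℕ → Set (Fin n → ℂ)) (hG : ∀ k, G k ∈ 𝒢) (ho : ∀ k, IsOpen (G k))
    (hmono : Monotone G) (hD : ⋃ k, G k = D) : IsExhaustedBy D 𝒢 := by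
  intro K hK hKD
  obtain ⟨k, hk⟩ := hK.elim_directed_cover G ho (hD ▸ hKD) hmono.directed_le
  exact ⟨G k, hG k, hk, hD ▸ Set.subset_iUnion G k⟩

/-- The Lie ball `L_n`, that is, the classical Cartan domain of type IV in `ℂⁿ`. -/
def lieBall (n : ℕ) : Set (Fin n → ℂ) :=
  {z | ∑ j, ‖z j‖ ^ 2 < 1 ∧
    Real.sqrt ((∑ j, ‖z j‖ ^ 2) ^ 2 - ‖∑ j, z j ^ 2‖ ^ 2) < 1 - ∑ j, ‖z j‖ ^ 2}

/-- The map `Λ_n (z₁, z₂, …, z_n) = (z₁², z₂, …, z_n)`. The first coordinate has index `0`. -/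
def squareFirst (n : ℕ) (z : Fin n → ℂ) : Fin n → ℂ :=
  fun j => if (j : ℕ) = 0 then z j ^ 2 else z j

/-- The domain `𝕃_n = Λ_n (L_n)`. -/
def lieBallQuotient (n : ℕ) : Set (Fin n → ℂ) :=
  squareFirst n '' lieBall n

open Filter Topology Asymptotics Metric Set

/-! In the coordinates `(x, z)` with `x = s ^ 2`, points of `𝕃_n` satisfy `|s ± iz| < 1`, so the
mean of `(s ± iz) ^ 8`, a polynomial in `x` and `z`, is bounded by `1`. The action `(l² x, l z)`
scales this polynomial by `l ^ 8`.

Suppose a subdomain with a chart `f` onto a convex domain contains the discs `l ↦ (l² ζ_k, l z_k)`,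
`|l| ≤ 1`. Averaging their `f`-images with weights `t_k` and pulling back by `g` gives a disc in
`𝕃_n`. Nonlinearity of `f` disturbs its order-two term only through `∑ t z² - (∑ t z)²`; when this
vanishes, the disc starts as `(l² ∑ t ζ, l ∑ t z)` (`chart_mean_sub_isLittleO`). Dividing the
polynomial by `l ^ 8` and applying the maximum principle bounds it by `1` at the mean point
(`norm_halfPowerSum_mean_le_one`). An explicit three-point mean violates this bound. -/

/-! ### Second-order expansions in holomorphic charts -/

/-- A map that is complex differentiable near a point is strictly differentiable there. -/
theorem hasStrictFDerivAt_of_differentiableOn_complex {E F : Type*} [NormedAddCommGroup E]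
    [NormedSpace ℂ E] [NormedAddCommGroup F] [NormedSpace ℂ F] {f : E → F} {U : Set E} {c : E}
    (hf : DifferentiableOn ℂ f U) (hU : U ∈ 𝓝 c) : HasStrictFDerivAt f (fderiv ℂ f c) c := by
  have hd : ∀ᶠ y in 𝓝 c, DifferentiableAt ℂ f y := hf.eventually_differentiableAt hU
  refine hasStrictFDerivAt_of_hasFDerivAt_of_continuousAt (f' := fderiv ℂ f)
    (hd.mono fun y hy => hy.hasFDerivAt) ?_
  rw [ContinuousAt, Metric.tendsto_nhds]
  intro ε hε
  -- Cauchy's estimate on the ball of radius `r = dist x c` about `x`: there `dist y c ≤ 2 * r`, so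
  -- the remainder varies by at most `ε / 6 * (2 * r + r) = ε / 2 * r`.
  have hlo := hd.self_of_nhds.hasFDerivAt.isLittleO.def (c := ε / 6) (by positivity)
  obtain ⟨δ, hδ, hball⟩ := Metric.eventually_nhds_iff.1 (hd.and hlo)
  refine Metric.eventually_nhds_iff.2 ⟨δ / 2, by positivity, fun x hx => ?_⟩
  rcases eq_or_ne x c with rfl | hne
  · simpa using hε
  have hr : 0 < dist x c := dist_pos.2 hne
  set r := dist x c
  set L := fderiv ℂ f c
  have hsub : ∀ y ∈ ball x r, dist y c < δ ∧ dist y c ≤ 2 * r := fun y hy => by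
    have := dist_triangle y x c
    rw [mem_ball] at hy
    constructor <;> linarith
  have hh : ∀ y, dist y c < δ → DifferentiableAt ℂ (fun y => f y - f c - L (y - c)) y :=
    fun y hy => ((hball hy).1.sub_const _).sub
      (L.differentiableAt.comp y (differentiableAt_id.sub_const c))
  have hxδ : dist x c < δ := by linarith
  have key := Complex.norm_fderiv_le_div_of_mapsTo_ball (f := fun y => f y - f c - L (y - c))
    (R₂ := ε / 2 * r)
    (fun y hy => (hh y (hsub y hy).1).differentiableWithinAt) (fun y hy => ?_) hr
  · have hfd : HasFDerivAt (fun y => f y - f c - L (y - c)) (fderiv ℂ f x - L) x := by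
      have h2 : HasFDerivAt (fun y => L (y - c)) L x := by
        exact L.hasFDerivAt.comp x ((hasFDerivAt_id x).sub_const c)
      exact ((hball hxδ).1.hasFDerivAt.sub_const _).sub h2
    rw [hfd.fderiv, mul_div_cancel_right₀ _ hr.ne'] at key
    rw [dist_eq_norm]
    linarith
  · have h1 := (hball (hsub y hy).1).2
    have h2 := (hball hxδ).2
    have h3 := (hsub y hy).2
    rw [← dist_eq_norm y c] at h1
    rw [← dist_eq_norm x c] at h2
    rw [mem_closedBall, dist_eq_norm]
    refine (norm_sub_le _ _).trans ?_
    nlinarith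

/-- Second-order expansion of a holomorphic map along the parabolas
`l ↦ (l z) v + (l² ζ) w`. -/
theorem exists_parabolic_expansion {E F : Type*} [NormedAddCommGroup E] [NormedSpace ℂ E]
    [NormedAddCommGroup F] [NormedSpace ℂ F] [CompleteSpace F] {f : E → F} {U : Set E}
    (hf : DifferentiableOn ℂ f U) (hU : U ∈ 𝓝 (0 : E)) (v w : E) :
    ∃ b β γ : F, ∀ z ζ : ℂ,
      (fun l : ℂ => f ((l * z) • v + (l ^ 2 * ζ) • w) -
        (f 0 + (l * z) • b + (l ^ 2 * z ^ 2) • β + (l ^ 2 * ζ) • γ)) =o[𝓝 0] fun l => l ^ 2 := by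
  have hd := hf.eventually_differentiableAt hU
  have ht : Tendsto (fun l : ℂ => l • v) (𝓝 0) (𝓝 0) := by
    have : Continuous fun l : ℂ => l • v := by fun_prop
    simpa using this.tendsto 0
  have hu : ∀ᶠ l in 𝓝 (0 : ℂ), DifferentiableAt ℂ (fun l : ℂ => f (l • v)) l :=
    (ht.eventually hd).mono fun l hl => by
      have h2 : DifferentiableAt ℂ (fun l : ℂ => l • v) l := by fun_prop
      exact hl.comp l h2
  obtain ⟨p, hp⟩ := Complex.analyticAt_iff_eventually_differentiableAt.2 hu
  have hO := hp.isBigO_sub_partialSum_pow 3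
  have hline : (fun l : ℂ => f (l • v) - (f 0 + l • p.coeff 1 + l ^ 2 • p.coeff 2))
      =o[𝓝 0] fun l => l ^ 2 := by
    have h0 : p.coeff 0 = f 0 := (hp.coeff_zero _).trans (by rw [zero_smul])
    refine (hO.congr_left fun l => ?_).trans_isLittleO ?_
    · simp only [FormalMultilinearSeries.partialSum, Finset.sum_range_succ, Finset.sum_range_zero,
        FormalMultilinearSeries.apply_eq_pow_smul_coeff, h0, zero_add, pow_zero, one_smul, pow_one]
    · have : (fun l : ℂ => l ^ 3) =o[𝓝 0] fun l => l ^ 2 := isLittleO_pow_pow (by norm_num)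
      simpa using this.norm_left
  refine ⟨p.coeff 1, p.coeff 2, fderiv ℂ f 0 w, fun z ζ => ?_⟩
  have hz : Tendsto (fun l : ℂ => l * z) (𝓝 0) (𝓝 0) := by
    have : Continuous fun l : ℂ => l * z := by fun_prop
    simpa using this.tendsto 0
  have h1 : (fun l : ℂ => f ((l * z) • v) -
      (f 0 + (l * z) • p.coeff 1 + (l * z) ^ 2 • p.coeff 2)) =o[𝓝 0] fun l => l ^ 2 := by
    refine (hline.comp_tendsto hz).trans_isBigO ?_
    refine (isBigO_const_mul_self (z ^ 2) (fun l : ℂ => l ^ 2) (𝓝 0)).congr_left fun l => ?_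
    simp only [Function.comp]
    ring
  have hc1 : Tendsto (fun l : ℂ => (l * z) • v + (l ^ 2 * ζ) • w) (𝓝 0) (𝓝 0) := by
    have : Continuous fun l : ℂ => (l * z) • v + (l ^ 2 * ζ) • w := by fun_prop
    simpa using this.tendsto 0
  have hc2 : Tendsto (fun l : ℂ => (l * z) • v) (𝓝 0) (𝓝 0) := ht.comp hz
  have hsub : (fun l : ℂ => ((l * z) • v + (l ^ 2 * ζ) • w) - (l * z) • v) =O[𝓝 0]
      fun l => l ^ 2 := by
    refine .of_bound ‖ζ • w‖ (.of_forall fun l => ?_)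
    rw [add_sub_cancel_left, mul_smul, norm_smul, mul_comm]
  -- Strictness is needed: both endpoints move with `l`, at distance `O(l²)` from each other.
  have h2 := ((hasStrictFDerivAt_of_differentiableOn_complex hf hU).isLittleO.comp_tendsto
    (by simpa only [nhds_prod_eq] using hc1.prodMk hc2)).trans_isBigO hsub
  refine (h1.add h2).congr_left fun l => ?_
  simp only [Function.comp, add_sub_cancel_left, map_smul, mul_pow]
  abel

/-- If finitely many points satisfy `∑ t z² = (∑ t z)²`, then pushing the weighted mean of their
parabolic orbits through a holomorphic chart changes nothing up to second order. -/
theorem chart_mean_sub_isLittleO {E F ι : Type*} [NormedAddCommGroup E] [NormedSpace ℂ E]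
    [NormedAddCommGroup F] [NormedSpace ℂ F] [CompleteSpace F] [Fintype ι]
    {f : E → F} {g : F → E} {U : Set E} {V : Set F}
    (hf : DifferentiableOn ℂ f U) (hU : U ∈ 𝓝 (0 : E)) (hg : DifferentiableOn ℂ g V)
    (hV : V ∈ 𝓝 (f 0)) (hgf : LeftInvOn g f U) (v w : E) (t : ι → ℝ) (z ζ : ι → ℂ)
    (ht : ∑ k, t k = 1) (hz : ∑ k, t k * z k ^ 2 = (∑ k, t k * z k) ^ 2) :
    (fun l : ℂ => g (∑ k, t k • f ((l * z k) • v + (l ^ 2 * ζ k) • w)) -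
      ((l * ∑ k, t k * z k) • v + (l ^ 2 * ∑ k, t k * ζ k) • w)) =o[𝓝 0] fun l => l ^ 2 := by
  obtain ⟨b, β, γ, h⟩ := exists_parabolic_expansion hf hU v w
  set Z := ∑ k, t k * z k with hZ
  set W := ∑ k, t k * ζ k with hW
  have htC : ∑ k, (t k : ℂ) = 1 := by exact_mod_cast ht
  have hcurve : ∀ a c : ℂ, Tendsto (fun l : ℂ => (l * a) • v + (l ^ 2 * c) • w) (𝓝 0) (𝓝 0) := by
    intro a c
    have : Continuous fun l : ℂ => (l * a) • v + (l ^ 2 * c) • w := by fun_prop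
    simpa using this.tendsto 0
  have hf0 : ContinuousAt f 0 := (hf.differentiableAt hU).continuousAt
  have hD : (fun l : ℂ => ∑ k, t k • f ((l * z k) • v + (l ^ 2 * ζ k) • w) -
      f ((l * Z) • v + (l ^ 2 * W) • w)) =o[𝓝 0] fun l => l ^ 2 := by
    have hs := (IsLittleO.sum fun k (_ : k ∈ Finset.univ) =>
      (h (z k) (ζ k)).const_smul_left (t k)).sub (h Z W)
    refine hs.congr_left fun l => ?_
    have e : ∑ k, t k • (f 0 + (l * z k) • b + (l ^ 2 * z k ^ 2) • β + (l ^ 2 * ζ k) • γ) =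
        f 0 + (l * Z) • b + (l ^ 2 * Z ^ 2) • β + (l ^ 2 * W) • γ := by
      -- The hypothesis on squares matches the `β` terms; all the others are affine in `(z, ζ)`.
      rw [← hz, hZ, hW]
      have hreal : ∀ (s : ℝ) (x : F), s • x = (s : ℂ) • x := fun _ _ => rfl
      simp only [hreal, smul_add, Finset.sum_add_distrib, smul_smul, Finset.mul_sum,
        ← Finset.sum_smul, htC, one_smul]
      congr 1
      · congr 1
        · congr 2
          exact Finset.sum_congr rfl fun _ _ => by ring
        · congr 1
          exact Finset.sum_congr rfl fun _ _ => by ring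
      · congr 1
        exact Finset.sum_congr rfl fun _ _ => by ring
    simp only [Finset.sum_apply, Pi.smul_apply, smul_sub, Finset.sum_sub_distrib, e]
    abel
  have hm2 : Tendsto (fun l : ℂ => f ((l * Z) • v + (l ^ 2 * W) • w)) (𝓝 0) (𝓝 (f 0)) :=
    hf0.tendsto.comp (hcurve Z W)
  have hm1 : Tendsto (fun l : ℂ => ∑ k, t k • f ((l * z k) • v + (l ^ 2 * ζ k) • w)) (𝓝 0)
      (𝓝 (f 0)) := by
    have := tendsto_finsetSum Finset.univ fun k _ =>
      (hf0.tendsto.comp (hcurve (z k) (ζ k))).const_smul (t k)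
    rwa [← Finset.sum_smul, ht, one_smul] at this
  have hlip := ((hasStrictFDerivAt_of_differentiableOn_complex hg hV).isBigO_sub.comp_tendsto
    (by simpa only [nhds_prod_eq] using hm1.prodMk hm2)).trans_isLittleO hD
  refine hlip.congr' ?_ .rfl
  filter_upwards [(hcurve Z W).eventually hU] with l hl
  simp only [Function.comp]
  rw [hgf hl]

/-! ### The weighted power sum and the maximum principle -/

/-- Removable singularity for a quotient by a power. -/
theorem exists_eq_pow_mul_of_isLittleO {a : ℂ → ℂ} {U : Set ℂ} (hU : U ∈ 𝓝 (0 : ℂ))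
    (ha : DifferentiableOn ℂ a U) (k : ℕ) (α : ℂ)
    (h : (fun l => a l - l ^ k * α) =o[𝓝 0] fun l : ℂ => l ^ k) :
    ∃ b : ℂ → ℂ, DifferentiableOn ℂ b U ∧ b 0 = α ∧ ∀ l, l ≠ 0 → a l = l ^ k * b l := by
  refine ⟨Function.update (fun l => a l / l ^ k) 0 α, ?_, by simp, fun l hl => ?_⟩
  · refine (Complex.differentiableOn_compl_singleton_and_continuousAt_iff hU).1 ⟨?_, ?_⟩
    · refine DifferentiableOn.congr (f := fun l => a l / l ^ k) ?_ fun l hl => ?_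
      · exact (ha.mono sdiff_subset).div (by fun_prop) fun l hl => pow_ne_zero _ hl.2
      · exact Function.update_of_ne hl.2 _ _
    · rw [continuousAt_update_same]
      have h1 := (h.mono (nhdsWithin_le_nhds (s := {0}ᶜ))).tendsto_div_nhds_zero
      have h2 := h1.add_const α
      rw [zero_add] at h2
      refine h2.congr' ?_
      filter_upwards [self_mem_nhdsWithin] with l hl
      have : l ^ k ≠ 0 := pow_ne_zero _ hl
      field_simp
      ring
  · rw [Function.update_of_ne hl]
    field_simp

/-- Half the eighth power sum `((s + i z)⁸ + (s - i z)⁸) / 2` as a polynomial in `s²` and `z`. -/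
def halfPowerSum (x z : ℂ) : ℂ :=
  x ^ 4 - 28 * x ^ 3 * z ^ 2 + 70 * x ^ 2 * z ^ 4 - 28 * x * z ^ 6 + z ^ 8

theorem halfPowerSum_smul (l x z : ℂ) :
    halfPowerSum (l ^ 2 * x) (l * z) = l ^ 8 * halfPowerSum x z := by
  unfold halfPowerSum
  ring

theorem halfPowerSum_sq (s z : ℂ) :
    halfPowerSum (s ^ 2) z = ((s + Complex.I * z) ^ 8 + (s - Complex.I * z) ^ 8) / 2 := by
  unfold halfPowerSum
  have h2 : Complex.I ^ 2 = -1 := Complex.I_sq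
  have h4 : Complex.I ^ 4 = 1 := Complex.I_pow_four
  have h6 : Complex.I ^ 6 = -1 := by linear_combination Complex.I ^ 2 * h4 + h2
  have h8 : Complex.I ^ 8 = 1 := by linear_combination (Complex.I ^ 4 + 1) * h4
  linear_combination (-28 * s ^ 6 * z ^ 2) * h2 - 70 * s ^ 4 * z ^ 4 * h4
    - 28 * s ^ 2 * z ^ 6 * h6 - z ^ 8 * h8

/-- The maximum principle for maps with weighted initial term `(l² α, l β)`. -/
theorem norm_halfPowerSum_le_of_isLittleO {a b : ℂ → ℂ} {U : Set ℂ} (hU : closedBall 0 1 ⊆ U)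
    (ha : DifferentiableOn ℂ a U) (hb : DifferentiableOn ℂ b U) {α β : ℂ}
    (hα : (fun l => a l - l ^ 2 * α) =o[𝓝 0] fun l : ℂ => l ^ 2)
    (hβ : (fun l => b l - l * β) =o[𝓝 0] fun l : ℂ => l)
    (h : ∀ l ∈ sphere (0 : ℂ) 1, ‖halfPowerSum (a l) (b l)‖ ≤ 1) :
    ‖halfPowerSum α β‖ ≤ 1 := by
  have hU0 : U ∈ 𝓝 (0 : ℂ) := mem_of_superset (closedBall_mem_nhds 0 one_pos) hU
  obtain ⟨A, hA, hA0, hAa⟩ := exists_eq_pow_mul_of_isLittleO hU0 ha 2 α hα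
  obtain ⟨B, hB, hB0, hBb⟩ := exists_eq_pow_mul_of_isLittleO hU0 hb 1 β (by simpa using hβ)
  have hN : DifferentiableOn ℂ (fun l => halfPowerSum (A l) (B l)) U := by
    unfold halfPowerSum
    fun_prop
  have := Complex.norm_le_of_forall_mem_frontier_norm_le (isBounded_ball (x := (0 : ℂ)) (r := 1))
    (hN.diffContOnCl_ball hU) (C := 1) (fun l hl => ?_) (subset_closure (mem_ball_self one_pos))
  · simpa [hA0, hB0] using this
  · rw [frontier_ball _ one_ne_zero] at hl
    have hl1 : ‖l‖ = 1 := by simpa using hl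
    have hl0 : l ≠ 0 := by
      rintro rfl
      simp at hl1
    have := h l hl
    rw [hAa l hl0, hBb l hl0, pow_one, halfPowerSum_smul] at this
    simpa [hl1] using this

/-! ### Bounds and points in the Lie ball and its quotient -/

/-- The difference under the root in the definition of the Lie ball dominates each square of a
`2 × 2` minor of the real and imaginary parts. -/
theorem four_mul_minor_sq_le {n : ℕ} (z : Fin n → ℂ) {i j : Fin n} (hij : i ≠ j) :
    4 * ((z i).re * (z j).im - (z j).re * (z i).im) ^ 2 ≤
      (∑ k, ‖z k‖ ^ 2) ^ 2 - ‖∑ k, z k ^ 2‖ ^ 2 := by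
  set x : Fin n → ℝ := fun k => (z k).re
  set y : Fin n → ℝ := fun k => (z k).im
  have h1 : ∑ k, ‖z k‖ ^ 2 = ∑ k, x k ^ 2 + ∑ k, y k ^ 2 := by
    rw [← Finset.sum_add_distrib]
    refine Finset.sum_congr rfl fun k _ => ?_
    rw [Complex.sq_norm, Complex.normSq_apply]
    ring
  have hre : (∑ k, z k ^ 2).re = ∑ k, x k ^ 2 - ∑ k, y k ^ 2 := by
    rw [Complex.re_sum, ← Finset.sum_sub_distrib]
    exact Finset.sum_congr rfl fun k _ => by simp [pow_two, x, y]
  have him : (∑ k, z k ^ 2).im = 2 * ∑ k, x k * y k := by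
    rw [Complex.im_sum, Finset.mul_sum]
    exact Finset.sum_congr rfl fun k _ => by simp [pow_two, x, y]; ring
  have hlag : ∑ k, ∑ l, (x k * y l - x l * y k) ^ 2 =
      2 * ((∑ k, x k ^ 2) * (∑ k, y k ^ 2) - (∑ k, x k * y k) ^ 2) := by
    have e : ∀ k l, (x k * y l - x l * y k) ^ 2 =
        x k ^ 2 * y l ^ 2 + y k ^ 2 * x l ^ 2 - 2 * ((x k * y k) * (x l * y l)) :=
      fun k l => by ring
    simp only [e, Finset.sum_add_distrib, Finset.sum_sub_distrib, ← Finset.mul_sum,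
      ← Finset.sum_mul]
    ring
  have hle : 2 * (x i * y j - x j * y i) ^ 2 ≤ ∑ k, ∑ l, (x k * y l - x l * y k) ^ 2 := by
    have hin : ∀ k l, (x k * y l - x l * y k) ^ 2 ≤ ∑ l, (x k * y l - x l * y k) ^ 2 := fun k l =>
      Finset.single_le_sum (f := fun l => (x k * y l - x l * y k) ^ 2)
        (fun _ _ => sq_nonneg _) (Finset.mem_univ l)
    have := Finset.add_le_sum (f := fun k => ∑ l, (x k * y l - x l * y k) ^ 2)
      (fun k _ => Finset.sum_nonneg fun _ _ => sq_nonneg _)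
      (Finset.mem_univ i) (Finset.mem_univ j) hij
    have a1 := hin i j
    have a2 := hin j i
    nlinarith
  rw [Complex.sq_norm, Complex.normSq_apply, hre, him, h1]
  rw [hlag] at hle
  change 4 * (x i * y j - x j * y i) ^ 2 ≤ _
  nlinarith

/-- `|z_i ± i z_j|²` equals `|z_i|² + |z_j|²` plus or minus twice a minor, and the square root in
the definition dominates that correction. -/
theorem norm_add_I_mul_lt_one {n : ℕ} {z : Fin n → ℂ} (hz : z ∈ lieBall n) {i j : Fin n}
    (hij : i ≠ j) : ‖z i + Complex.I * z j‖ < 1 ∧ ‖z i - Complex.I * z j‖ < 1 := by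
  have hroot := Real.abs_le_sqrt ((le_of_eq (by ring)).trans (four_mul_minor_sq_le z hij) :
    (2 * ((z i).re * (z j).im - (z j).re * (z i).im)) ^ 2 ≤ _)
  have hsum : ‖z i‖ ^ 2 + ‖z j‖ ^ 2 ≤ ∑ k, ‖z k‖ ^ 2 :=
    Finset.add_le_sum (f := fun k => ‖z k‖ ^ 2) (fun k _ => sq_nonneg _)
      (Finset.mem_univ i) (Finset.mem_univ j) hij
  have hlt := hz.2
  rw [abs_le] at hroot
  constructor <;>
  · refine (sq_lt_one_iff₀ (norm_nonneg _)).1 ?_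
    rw [Complex.sq_norm, Complex.normSq_apply] at *
    rw [Complex.sq_norm, Complex.normSq_apply] at hsum
    simp
    nlinarith

theorem norm_halfPowerSum_le_one {n : ℕ} {x : Fin n → ℂ} (hx : x ∈ lieBallQuotient n)
    {i j : Fin n} (hi : (i : ℕ) = 0) (hij : i ≠ j) : ‖halfPowerSum (x i) (x j)‖ ≤ 1 := by
  obtain ⟨z, hz, rfl⟩ := hx
  have hj : (j : ℕ) ≠ 0 := fun h => hij (Fin.ext (hi.trans h.symm))
  obtain ⟨h1, h2⟩ := norm_add_I_mul_lt_one hz hij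
  simp only [squareFirst, hi, hj, if_true, if_false]
  rw [halfPowerSum_sq, norm_div]
  have a1 := pow_le_one₀ (n := 8) (norm_nonneg _) h1.le
  have a2 := pow_le_one₀ (n := 8) (norm_nonneg _) h2.le
  rw [← norm_pow] at a1 a2
  have := norm_add_le ((z i + Complex.I * z j) ^ 8) ((z i - Complex.I * z j) ^ 8)
  simp only [Complex.norm_ofNat]
  linarith

theorem single_mem_lieBall {n : ℕ} (i : Fin n) {c : ℂ} (hc : ‖c‖ < 1) :
    Pi.single i c ∈ lieBall n := by
  have h1 : ∑ j, ‖(Pi.single i c : Fin n → ℂ) j‖ ^ 2 = ‖c‖ ^ 2 := by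
    rw [Finset.sum_eq_single i] <;> simp +contextual
  have h2 : ∑ j, (Pi.single i c : Fin n → ℂ) j ^ 2 = c ^ 2 := by
    rw [Finset.sum_eq_single i] <;> simp +contextual
  have h3 : ‖c‖ ^ 2 < 1 := (sq_lt_one_iff₀ (norm_nonneg _)).2 hc
  refine ⟨by rwa [h1], ?_⟩
  rw [h1, h2]
  simpa using h3

theorem single_mem_lieBallQuotient {n : ℕ} {j : Fin n} (hj : (j : ℕ) ≠ 0) {c : ℂ} (hc : ‖c‖ < 1) :
    Pi.single j c ∈ lieBallQuotient n := by
  refine ⟨_, single_mem_lieBall j hc, funext fun k => ?_⟩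
  by_cases hk : (k : ℕ) = 0
  · have : k ≠ j := fun h => hj (h ▸ hk)
    simp [squareFirst, this]
  · simp [squareFirst, hk]

theorem single_sq_mem_lieBallQuotient {n : ℕ} {i : Fin n} (hi : (i : ℕ) = 0) {c : ℂ}
    (hc : ‖c‖ < 1) : Pi.single i (c ^ 2) ∈ lieBallQuotient n := by
  refine ⟨_, single_mem_lieBall i hc, funext fun k => ?_⟩
  by_cases hk : k = i
  · subst hk
    simp [squareFirst, hi]
  · simp [squareFirst, hk]

/-! ### Averaging discs and the contradiction -/

/-- Weighted means of points of `𝕃_n` in the first two coordinates satisfy the polynomial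
inequality, as soon as `∑ t z² = (∑ t z)²` and `𝕃_n` is exhausted by convex images. -/
theorem norm_halfPowerSum_mean_le_one {n : ℕ} {ι : Type*} [Fintype ι] {i j : Fin n}
    (hi : (i : ℕ) = 0) (hij : i ≠ j)
    (hex : IsExhaustedBy (lieBallQuotient n) (domainsBiholomorphicToConvex n))
    (t : ι → ℝ) (z ζ : ι → ℂ) (ht0 : ∀ k, 0 ≤ t k) (ht : ∑ k, t k = 1)
    (hz : ∑ k, t k * z k ^ 2 = (∑ k, t k * z k) ^ 2)
    (hmem : ∀ k, ∀ l ∈ closedBall (0 : ℂ) 1, (l * z k) • (Pi.single j 1 : Fin n → ℂ) +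
      (l ^ 2 * ζ k) • (Pi.single i 1 : Fin n → ℂ) ∈ lieBallQuotient n) :
    ‖halfPowerSum (∑ k, t k * ζ k) (∑ k, t k * z k)‖ ≤ 1 := by
  set c : ι → ℂ → Fin n → ℂ := fun k l =>
    (l * z k) • (Pi.single j 1 : Fin n → ℂ) + (l ^ 2 * ζ k) • (Pi.single i 1 : Fin n → ℂ) with hc
  have hcd : ∀ k, Differentiable ℂ (c k) := fun k => by
    simp only [hc]
    fun_prop
  have hne : Nonempty ι := by
    by_contra h
    rw [not_nonempty_iff] at h
    simp at ht
  obtain ⟨G, ⟨⟨hGo, -⟩, C, ⟨hCo, -⟩, hconv, f, g, hf, hg, hfm, hgm, hgf, -⟩, hKG, hGD⟩ :=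
    hex (⋃ k, c k '' closedBall 0 1)
      (isCompact_iUnion fun k => (isCompact_closedBall 0 1).image (hcd k).continuous)
      (iUnion_subset fun k => by
        rintro _ ⟨l, hl, rfl⟩
        exact hmem k l hl)
  have hcG : ∀ k, ∀ l ∈ closedBall (0 : ℂ) 1, c k l ∈ G := fun k l hl =>
    hKG (mem_iUnion.2 ⟨k, mem_image_of_mem _ hl⟩)
  have h0G : (0 : Fin n → ℂ) ∈ G := by
    simpa [hc] using hcG hne.some 0 (by simp)
  set U : Set ℂ := ⋂ k, c k ⁻¹' G
  have hUc : closedBall 0 1 ⊆ U := fun l hl => mem_iInter.2 fun k => hcG k l hl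
  set m : ℂ → Fin n → ℂ := fun l => ∑ k, t k • f (c k l)
  have hmC : MapsTo m U C := fun l hl =>
    hconv.sum_mem (fun k _ => ht0 k) ht fun k _ => hfm (mem_iInter.1 hl k)
  have hmd : DifferentiableOn ℂ m U := DifferentiableOn.fun_sum fun k _ =>
    (hf.comp (hcd k).differentiableOn fun l hl => mem_iInter.1 hl k).const_smul (t k)
  have hφ : DifferentiableOn ℂ (fun l => g (m l)) U := hg.comp hmd hmC
  have hlo := chart_mean_sub_isLittleO hf (hGo.mem_nhds h0G) hg (hCo.mem_nhds (hfm h0G)) hgf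
    (Pi.single j 1) (Pi.single i 1) t z ζ ht hz
  have hlo' := isLittleO_pi.1 hlo
  refine norm_halfPowerSum_le_of_isLittleO (a := fun l => g (m l) i) (b := fun l => g (m l) j) hUc
    (differentiableOn_pi.1 hφ i) (differentiableOn_pi.1 hφ j) ?_ ?_ fun l hl => ?_
  · simpa [hij] using hlo' i
  · have h1 : (fun l : ℂ => l ^ 2) =o[𝓝 0] fun l => l := by
      simpa using isLittleO_pow_pow (𝕜 := ℂ) (m := 1) (n := 2) (by norm_num)
    refine IsLittleO.trans ?_ h1
    simpa [hij.symm] using hlo' j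
  · exact norm_halfPowerSum_le_one (hGD (hgm (hmC (hUc (sphere_subset_closedBall hl))))) hi hij

theorem mainTheorem2 (n : ℕ) (hn : 2 ≤ n) :
    ¬ IsExhaustedBy (lieBallQuotient n) (domainsBiholomorphicToConvex n) := by
  intro hex
  let i : Fin n := ⟨0, by omega⟩
  let j : Fin n := ⟨1, by omega⟩
  have hij : i ≠ j := by simp [i, j]
  -- Any `r < 1` keeps the closed discs inside `𝕃_n`; this one is close enough to `1` that `r ^ 8 *
  -- ((11/10) ^ 8 + (2/5) ^ 8) / 2 > 1`.
  set r : ℂ := 199 / 200 with hr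
  have hrn : ‖r‖ < 1 := by rw [hr]; norm_num
  have hu : ∀ s : ℝ, s ^ 2 = 9 / 25 → ‖r * (4 / 5 + s * Complex.I)‖ < 1 := fun s hs => by
    have : ‖(4 / 5 + s * Complex.I : ℂ)‖ = 1 := by
      rw [← sq_eq_sq₀ (norm_nonneg _) zero_le_one, Complex.sq_norm, Complex.normSq_apply]
      simp
      nlinarith
    rwa [norm_mul, this, mul_one]
  have hmul : ∀ {l c : ℂ}, l ∈ closedBall (0 : ℂ) 1 → ‖c‖ < 1 → ‖l * c‖ < 1 := fun hl hc => by
    rw [norm_mul]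
    exact (mul_le_of_le_one_left (norm_nonneg _) (by simpa using hl)).trans_lt hc
  have hp := hu (3 / 5) (by norm_num)
  have hm := hu (-(3 / 5)) (by norm_num)
  -- For `u = 4/5 ± 3i/5` the total weight `7/16` gives `∑ t u = 7/20` and `∑ t u² = 49/400`, its
  -- square. The mean point has `s = 3ir/4`, `z = 7r/20`, so `|s ± iz|` are `11r/10` and `2r/5`. The
  -- exponent `8` is the least `p` with `(11/10) ^ p > 2`.
  have := norm_halfPowerSum_mean_le_one (i := i) (j := j) rfl hij hex ![7 / 32, 7 / 32, 9 / 16]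
    ![r * (4 / 5 + (3 / 5 : ℝ) * Complex.I), r * (4 / 5 + (-(3 / 5) : ℝ) * Complex.I), 0]
    ![0, 0, -r ^ 2] ?_ ?_ ?_ ?_
  · have e : halfPowerSum (-(9 / 16) * r ^ 2) (7 / 20 * r) =
        r ^ 8 * (((11 / 10) ^ 8 + (2 / 5) ^ 8) / 2) := by
      unfold halfPowerSum
      ring
    have eζ : ∑ k, ((![7 / 32, 7 / 32, 9 / 16] : Fin 3 → ℝ) k : ℂ) *
        (![0, 0, -r ^ 2] : Fin 3 → ℂ) k = -(9 / 16) * r ^ 2 := by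
      simp [Fin.sum_univ_three]
    have ez : ∑ k, ((![7 / 32, 7 / 32, 9 / 16] : Fin 3 → ℝ) k : ℂ) *
        (![r * (4 / 5 + (3 / 5 : ℝ) * Complex.I), r * (4 / 5 + (-(3 / 5) : ℝ) * Complex.I), 0] :
          Fin 3 → ℂ) k = 7 / 20 * r := by
      simp [Fin.sum_univ_three]
      ring
    rw [eζ, ez, e, hr] at this
    norm_num at this
  · intro k
    fin_cases k <;> norm_num
  · simp [Fin.sum_univ_three]
    norm_num
  · simp [Fin.sum_univ_three]
    ring_nf
    simp
    ring
  · intro k l hl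
    fin_cases k
    · simpa [← Pi.single_smul] using single_mem_lieBallQuotient (j := j) (by simp [j]) (hmul hl hp)
    · simpa [← Pi.single_smul] using single_mem_lieBallQuotient (j := j) (by simp [j]) (hmul hl hm)
    · have hI : ‖Complex.I * r‖ < 1 := by simpa using hrn
      have := single_sq_mem_lieBallQuotient (i := i) rfl (hmul hl hI)
      simpa [← Pi.single_smul, mul_pow, Pi.single_neg] using this
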